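/- A baby-step giant-step algorithm with splitting parameter $m\ge 1$ evaluates a sum $\sum_{e\le T} c_e q^e$ (finitely many terms, $c_e\in\mathbb Z$ given as signed repeated summands, $T$ the largest exponent) as $$\sum_{k=0}^{\lfloor T/m\rfloor}(q^m)^k\sum_{0\le j<m}c_{mk+j}\,q^j .$$ The baby-steps compute $q^m$ and the powers $q^j$ for the nonzero residues $j$ modulo $m$ of the exponents that occur, by an addition sequence, with one multiplication for each of its elements $>1$. The addition sequence is obtained from these exponents by inserting $\lfloor c/2\rfloor$ and $\lceil c/2\rceil$ as long as some element $c\neq 1$ is not a sum of two smaller elements, treating the elements from the largest to the smallest. The giant-steps evaluate the outer polynomial in $q^m$ by Horner's rule with $\lfloor T/m\rfloor$ multiplications. All multiplications (including squarings) are counted; additions and subtractions are not. Let $c$ be the effective constant $1/8$. Let $F\in\mathbb Q[X]$ be a fixed polynomial of degree $2$ that takes integral values at all integers and satisfies $F(n)\ge 0$ for all integers $n\ge 1$. For every sufficiently large $N$ (depending on $F$) there is a $k\ge 0$ such that, for $m$ the product of the first $k$ primes that are different from $2$ and divide neither the leading coefficient (numerator or denominator) nor the denominator of any other coefficient of $F$,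 the baby-step giant-step algorithm with splitting parameter $m$ computes $$\sum_{n=1}^N q^{F(n)}$$ for every element $q$ of every ring, with fewer than $N^{1-c/\log\log N}$ multiplications. This bound grows more slowly than $N/\log^r N$ for every $r>0$, that is, $N^{1-c/\log\log N}=o(N/\log^r N)$. The same bound $N^{1-c/\log\log N}$ holds, for all sufficiently large $N$ and with $m$ chosen in this way (for some $k$) for the polynomial $F$ indicated, for the following series truncated to their first $N$ terms (in order of increasing exponents): - $\eta$, without the factor $q^{1/24}$: $\sum_{n\in\mathbb Z}(-1)^n q^{n(3n-1)/2}$, with $F=\tfrac{3X^2-X}{2}$; - $\theta_0$: $1+2\sum_{n\ge1}q^{n^2}$, with $F=X^2$; - $\theta_1$: $1+2\sum_{n\ge1}(-1)^nq^{n^2}$, with $F=X^2$; - $\theta_2$, without the factor $q^{1/4}$: $2\sum_{n\ge0}q^{n(n+1)}$, with $F=X^2+X$. -/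

import Mathlib

universe u

namespace BSGS

/-- One instruction of a straight-line program over a ring.  Registers are numbered by natural
numbers; `d` is the destination, `i` and `j` are the sources. -/
inductive Instr : Type
  | one (d : ℕ) : Instr
  | add (d i j : ℕ) : Instr
  | sub (d i j : ℕ) : Instr
  | mul (d i j : ℕ) : Instr

/-- The effect of one instruction on the contents `s` of the registers. -/
def Instr.exec {R : Type*} [Ring R] (s : ℕ → R) : Instr → (ℕ → R)
  | Instr.one d => Function.update s d 1
  | Instr.add d i j => Function.update s d (s i + s j)
  | Instr.sub d i j => Function.update s d (s i - s j)
  | Instr.mul d i j => Function.update s d (s i * s j)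

/-- The number of multiplications of one instruction. Every multiplication in the ring is counted,
squarings included; additions and subtractions are free. -/
def Instr.muls : Instr → ℕ
  | Instr.mul _ _ _ => 1
  | _ => 0

/-- A straight-line program: its instructions, in order, and the register holding the result. -/
structure Program : Type where
  code : List Instr
  out : ℕ

/-- The result of the program on input `q`: register `1` holds `q` at the start and all the other
registers hold `0`. -/
def Program.eval {R : Type*} [Ring R] (P : Program) (q : R) : R :=
  P.code.foldl Instr.exec (fun i : ℕ => if i = 1 then q else 0) P.out

/-- The number of multiplications performed by the program. -/
def Program.muls (P : Program) : ℕ := (P.code.map Instr.muls).sum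

/-- `c` is a sum of two (positive) elements of `A`. -/
def IsPairSum (A : Finset ℕ) (c : ℕ) : Prop :=
  ∃ a ∈ A, ∃ b ∈ A, 0 < a ∧ 0 < b ∧ a + b = c

instance (A : Finset ℕ) (c : ℕ) : Decidable (IsPairSum A c) := by
  unfold IsPairSum; infer_instance

/-- Go through `c, c - 1, …, 1`; whenever the current number is an element of the set other than `1`
and is not a sum of two smaller elements, insert its two halves (rounded down and up). -/
def halve : ℕ → Finset ℕ → Finset ℕ
  | 0, A => A
  | c + 1, A =>
      halve c (if c + 1 ∈ A ∧ c + 1 ≠ 1 ∧ ¬ IsPairSum A (c + 1)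
        then insert ((c + 1) / 2) (insert ((c + 2) / 2) A) else A)

/-- The short addition sequence containing a finite set `E` of positive integers: as long as
some element `c ≠ 1` is not a sum of two smaller elements, insert `⌊c / 2⌋` and `⌈c / 2⌉`.
The elements are treated from the largest to the smallest, so that one pass suffices. -/
def additionSequence (E : Finset ℕ) : Finset ℕ := halve (E.sup id) E

/-- The smallest summand `a` in a decomposition `c = a + (c - a)` into two smaller elements
of `A` (and `0` if there is none). -/
def summand (A : Finset ℕ) (c : ℕ) : ℕ :=
  ((List.range c).find? (fun a => decide (0 < a ∧ a ∈ A ∧ c - a ∈ A))).getD 0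

/-- Computing `q ^ c` into register `c` for all `c` in the addition sequence `A`, in increasing
order, with one multiplication for each `c > 1`. -/
def powers (A : Finset ℕ) : List Instr :=
  ((A.sort (· ≤ ·)).filter (fun c => decide (1 < c))).map
    (fun c => Instr.mul c (summand A c) (c - summand A c))

/-- The baby-step exponents for the splitting parameter `m` and a list of terms `± q ^ e`:
the distinct nonzero residues of the exponents modulo `m`, and `m` itself. -/
def babyExponents (m : ℕ) (terms : List (ℤˣ × ℕ)) : Finset ℕ :=
  insert m ((terms.map (fun t => t.2 % m)).toFinset.erase 0)

/-- Adding to the accumulator (register `m + 1`) the inner sum with index `k`, that is,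
`∑ ± q ^ (e % m)` over the terms `± q ^ e` with `⌊e / m⌋ = k`. -/
def inner (m : ℕ) (terms : List (ℤˣ × ℕ)) (k : ℕ) : List Instr :=
  (terms.filter (fun t => decide (t.2 / m = k))).map
    (fun t => if t.1 = 1 then Instr.add (m + 1) (m + 1) (t.2 % m)
      else Instr.sub (m + 1) (m + 1) (t.2 % m))

/-- Horner's rule in `q ^ m`, from the inner sum with index `k` down to the one with index `0`. -/
def horner (m : ℕ) (terms : List (ℤˣ × ℕ)) : ℕ → List Instr
  | 0 => inner m terms 0
  | k + 1 => inner m terms (k + 1) ++ Instr.mul (m + 1) (m + 1) m :: horner m terms k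

/-- The largest exponent of a list of terms `± q ^ e`. -/
def maxExponent (terms : List (ℤˣ × ℕ)) : ℕ := (terms.map Prod.snd).foldr max 0

/-- The baby-step giant-step algorithm with splitting parameter `m` for evaluating
`∑ ± q ^ e`, the sum being given by the list of its terms: the sum is written as
`∑_{k ≤ T / m} (q ^ m) ^ k * (∑_{j < m} c_{m k + j} q ^ j)`, where `T` is the largest exponent;
the powers `q ^ j` that occur, and `q ^ m`, are computed by an addition sequence (baby-steps),
and the outer polynomial in `q ^ m` is evaluated by Horner's rule (giant-steps). -/
def bsgs (m : ℕ) (terms : List (ℤˣ × ℕ)) : Program where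
  code := Instr.one 0 :: powers (additionSequence (babyExponents m terms)) ++
    horner m terms (maxExponent terms / m)
  out := m + 1

/-- The primes that are used for the splitting parameter: all those except `2` and the
primes dividing the leading coefficient or the denominator of a coefficient of `F`. -/
def SuitablePrime (F : Polynomial ℚ) (p : ℕ) : Prop :=
  p.Prime ∧ p ≠ 2 ∧ ¬ ((p : ℤ) ∣ F.leadingCoeff.num) ∧ ∀ i : ℕ, ¬ (p ∣ (F.coeff i).den)

/-- The product of the first `k` suitable primes. -/
noncomputable def modulus (F : Polynomial ℚ) (k : ℕ) : ℕ :=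
  ∏ i ∈ Finset.range k, Nat.nth (SuitablePrime F) i

/-- The bound `N ^ (1 - c / log log N)`. -/
noncomputable def bound (c : ℝ) (N : ℕ) : ℝ :=
  (N : ℝ) ^ (1 - c / Real.log (Real.log (N : ℝ)))

/-- The terms `q ^ (e n)` for `1 ≤ n ≤ N`. -/
def seqTerms (e : ℕ → ℕ) (N : ℕ) : List (ℤˣ × ℕ) :=
  (List.range N).map (fun i => (1, e (i + 1)))

/-- The indices `0, 1, -1, 2, -2, 3, …`, for which the generalized pentagonal numbers
`n (3 n - 1) / 2` appear in increasing order `0, 1, 2, 5, 7, 12, …`. -/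
def pentagonalIndex (j : ℕ) : ℤ :=
  if j % 2 = 1 then (((j + 1) / 2 : ℕ) : ℤ) else -((j / 2 : ℕ) : ℤ)

/-- The first `N` terms of `∑_{n ∈ ℤ} (-1) ^ n q ^ (n (3 n - 1) / 2)`, by increasing exponents. -/
def etaTerms (N : ℕ) : List (ℤˣ × ℕ) :=
  (List.range N).map
    (fun j => ((-1) ^ (pentagonalIndex j).natAbs, pentagonal (pentagonalIndex j)))

/-- The first `N` terms of `1 + 2 ∑_{n ≥ 1} ε ^ n q ^ (n ^ 2)`, where `2 ε ^ n q ^ (n ^ 2)` is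
entered as two equal summands. -/
def squareTerms (ε : ℤˣ) (N : ℕ) : List (ℤˣ × ℕ) :=
  (List.range N).flatMap (fun n =>
    if n = 0 then [(1, 0)] else [(ε ^ n, n ^ 2), (ε ^ n, n ^ 2)])

/-- The first `N` terms of `2 ∑_{n ≥ 0} q ^ (n (n + 1))`, where `2 q ^ (n (n + 1))` is entered as
two equal summands. -/
def trigonalTerms (N : ℕ) : List (ℤˣ × ℕ) :=
  (List.range N).flatMap (fun n => [(1, n * (n + 1)), (1, n * (n + 1))])

end BSGS

/-! Modulo an odd prime `p` not dividing the leading coefficient or a denominator, completing the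
square shows that a quadratic `F` takes at most `(p + 1) / 2` values. By the Chinese remainder
theorem, for a product `m` of `k` such primes the exponents fall into at most `(k + 1) * m / 2 ^ k`
residue classes (`card_image_mod_modulus_le`). An addition sequence built by halving costs only a
factor `O(log m)` more, so the baby-steps cost about `m / 2 ^ k` up to powers of `k`, and the
giant-steps cost `O(N ^ 2 / m)`.

The two balance for `m` near `N * √2 ^ k`. Taking the least `k` with `m ≥ N * √2 ^ k`
(`exists_balanced`) overshoots by at most the factor `k ^ 2`, since Chebyshev's lower bound for the
prime counting function keeps the last prime below `k ^ 2` (`eventually_nth_suitablePrime_lt`). The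
cost is then `O(N * k ^ 5 / √2 ^ k)`, which is below `N * exp (-k / 4)` for large `k`. Finally `N ≤
m ≤ k ^ (2 * k)` forces `log N / log log N ≤ 2 * k` (`log_div_log_log_le`), and `1/4` divided by `2`
is the constant `1/8`. -/

namespace BSGS

/-! ### Semantics of the straight-line programs -/

section Semantics

variable {R : Type*} [Ring R]

/-- The sum of a list of terms `± q ^ e`. -/
def termSum (q : R) (terms : List (ℤˣ × ℕ)) : R :=
  (terms.map (fun t => ((t.1 : ℤ) : R) * q ^ t.2)).sum

/-- Running multiplications for increasing exponents whose summands are available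
computes the corresponding powers and leaves the other registers alone. -/
theorem foldl_powers (q : R) (f : ℕ → ℕ) (l : List ℕ) (hl : l.Pairwise (· < ·)) (s : ℕ → R)
    (h : ∀ x ∈ l, f x < x ∧ x - f x < x ∧ (s (f x) = q ^ f x ∨ f x ∈ l) ∧
      (s (x - f x) = q ^ (x - f x) ∨ x - f x ∈ l)) :
    (∀ a, (s a = q ^ a ∨ a ∈ l) →
      (l.map (fun c => Instr.mul c (f c) (c - f c))).foldl Instr.exec s a = q ^ a) ∧
    (∀ a, a ∉ l → (l.map (fun c => Instr.mul c (f c) (c - f c))).foldl Instr.exec s a = s a) := by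
  induction l generalizing s with
  | nil => simp
  | cons c l ih =>
    obtain ⟨hc, hl'⟩ := List.pairwise_cons.1 hl
    have hmin : ∀ u, u < c → u ∉ c :: l := by
      intro u hu hm
      rcases List.mem_cons.1 hm with rfl | hm
      · omega
      · have := hc u hm; omega
    obtain ⟨h1, h2, h3, h4⟩ := h c (by simp)
    -- Both summands lie below `c`, the least exponent still pending, so their registers are already
    -- final.
    have e1 : s (f c) = q ^ f c := h3.resolve_right (hmin _ h1)
    have e2 : s (c - f c) = q ^ (c - f c) := h4.resolve_right (hmin _ h2)
    have e3 : s (f c) * s (c - f c) = q ^ c := by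
      rw [e1, e2, ← pow_add]; congr 1; omega
    have key : ∀ a, (s a = q ^ a ∨ a ∈ c :: l) →
        (Function.update s c (q ^ c) a = q ^ a ∨ a ∈ l) := by
      intro a ha
      by_cases hac : a = c
      · subst hac; left; simp
      · rw [Function.update_of_ne hac]
        rcases ha with ha | ha
        · exact Or.inl ha
        · exact Or.inr ((List.mem_cons.1 ha).resolve_left hac)
    have := ih hl' (Function.update s c (q ^ c)) (by
      intro x hx
      obtain ⟨g1, g2, g3, g4⟩ := h x (by simp [hx])
      exact ⟨g1, g2, key _ g3, key _ g4⟩)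
    simp only [List.map_cons, List.foldl_cons, Instr.exec, e3]
    refine ⟨fun a ha => this.1 a (key a ha), fun a ha => ?_⟩
    rw [this.2 a (fun h => ha (by simp [h])), Function.update_of_ne]
    rintro rfl
    simp at ha

/-- The sum of the terms `± q ^ (e % m)` with `e / m = k`. -/
def innerSum (q : R) (m : ℕ) (terms : List (ℤˣ × ℕ)) (k : ℕ) : R :=
  (terms.map (fun t => if t.2 / m = k then ((t.1 : ℤ) : R) * q ^ (t.2 % m) else 0)).sum

theorem foldl_inner (q : R) {m : ℕ} (hm : 0 < m) (terms : List (ℤˣ × ℕ)) (k : ℕ) (s : ℕ → R)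
    (h : ∀ t ∈ terms, s (t.2 % m) = q ^ (t.2 % m)) :
    (inner m terms k).foldl Instr.exec s =
      Function.update s (m + 1) (s (m + 1) + innerSum q m terms k) := by
  induction terms generalizing s with
  | nil => simp [inner, innerSum]
  | cons t l ih =>
    -- Residues stay below `m`, so no power is ever overwritten by the accumulator in register `m +
    -- 1`.
    have hr : t.2 % m ≠ m + 1 := by have := Nat.mod_lt t.2 hm; omega
    have ht := h t (by simp)
    have hl : ∀ v, ∀ t ∈ l, Function.update s (m + 1) v (t.2 % m) = q ^ (t.2 % m) := by
      intro v t ht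
      rw [Function.update_of_ne (by have := Nat.mod_lt t.2 hm; omega)]
      exact h t (by simp [ht])
    by_cases hk : t.2 / m = k
    · have hcons : inner m (t :: l) k = (if t.1 = 1 then Instr.add (m + 1) (m + 1) (t.2 % m)
          else Instr.sub (m + 1) (m + 1) (t.2 % m)) :: inner m l k := by
        simp [inner, hk]
      have hexec : Instr.exec s (if t.1 = 1 then Instr.add (m + 1) (m + 1) (t.2 % m)
          else Instr.sub (m + 1) (m + 1) (t.2 % m)) =
          Function.update s (m + 1) (s (m + 1) + ((t.1 : ℤ) : R) * q ^ (t.2 % m)) := by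
        rcases Int.units_eq_one_or t.1 with h1 | h1
        · simp [h1, Instr.exec, ht]
        · simp [h1, Instr.exec, ht, sub_eq_add_neg]
      rw [hcons, List.foldl_cons, hexec, ih _ (hl _)]
      simp [innerSum, hk, add_assoc]
    · have hcons : inner m (t :: l) k = inner m l k := by
        simp [inner, hk]
      rw [hcons, ih _ (fun t ht => h t (by simp [ht]))]
      simp [innerSum, hk]

/-- The initial content of the accumulator is arbitrary so that the induction applies after each
multiplication by `q ^ m`. -/
theorem foldl_horner (q : R) {m : ℕ} (hm : 0 < m) (terms : List (ℤˣ × ℕ)) (k : ℕ) (s : ℕ → R)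
    (hq : s m = q ^ m) (h : ∀ t ∈ terms, s (t.2 % m) = q ^ (t.2 % m)) :
    (horner m terms k).foldl Instr.exec s (m + 1) =
      s (m + 1) * (q ^ m) ^ k +
        ∑ j ∈ Finset.range (k + 1), innerSum q m terms j * (q ^ m) ^ j := by
  induction k generalizing s with
  | zero => simp [horner, foldl_inner q hm terms 0 s h]
  | succ k ih =>
    rw [horner, List.foldl_append, foldl_inner q hm terms _ s h, List.foldl_cons]
    simp only [Instr.exec]
    rw [ih]
    · simp only [Function.update_self, Function.update_of_ne (show m ≠ m + 1 by omega), hq]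
      rw [Finset.sum_range_succ _ (k + 1), pow_succ' (q ^ m) k]
      noncomm_ring
    · rw [Function.update_of_ne (by omega), Function.update_of_ne (by omega), hq]
    · intro t ht
      have : t.2 % m ≠ m + 1 := by have := Nat.mod_lt t.2 hm; omega
      rw [Function.update_of_ne this, Function.update_of_ne this, h t ht]

/-- Each exponent `e` contributes to the single index `e / m`, and `e = e % m + m * (e / m)`
reassembles the power. -/
theorem sum_innerSum (q : R) (m : ℕ) (terms : List (ℤˣ × ℕ)) (K : ℕ)
    (h : ∀ t ∈ terms, t.2 / m < K) :
    ∑ j ∈ Finset.range K, innerSum q m terms j * (q ^ m) ^ j = termSum q terms := by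
  induction terms with
  | nil => simp [innerSum, termSum]
  | cons t l ih =>
    have hl := ih (fun t ht => h t (by simp [ht]))
    have ht := h t (by simp)
    simp only [innerSum, termSum, List.map_cons, List.sum_cons] at hl ⊢
    simp only [add_mul, Finset.sum_add_distrib, hl, ite_mul, zero_mul]
    rw [Finset.sum_ite_eq, if_pos (by simpa using ht), mul_assoc, ← pow_mul, ← pow_add,
      Nat.mod_add_div]

end Semantics

/-! ### Addition sequences by halving -/

theorem IsPairSum.mono {A B : Finset ℕ} (h : A ⊆ B) {c : ℕ} : IsPairSum A c → IsPairSum B c :=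
  fun ⟨a, ha, b, hb, r⟩ => ⟨a, h ha, b, h hb, r⟩

theorem subset_halve (c : ℕ) (A : Finset ℕ) : A ⊆ halve c A := by
  induction c generalizing A with
  | zero => simp [halve]
  | succ c ih =>
    rw [halve]
    refine Finset.Subset.trans ?_ (ih _)
    split_ifs
    · exact (Finset.subset_insert _ _).trans (Finset.subset_insert _ _)
    · exact Finset.Subset.refl _

/-- A property of the elements that passes to both halves is preserved by `halve`. -/
theorem halve_induction {P : ℕ → Prop} (hP : ∀ x, 2 ≤ x → P x → P (x / 2) ∧ P ((x + 1) / 2))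
    (c : ℕ) (A : Finset ℕ) (hA : ∀ x ∈ A, P x) : ∀ x ∈ halve c A, P x := by
  induction c generalizing A with
  | zero => simpa [halve] using hA
  | succ c ih =>
    rw [halve]
    apply ih
    split_ifs with h
    · obtain ⟨h1, h2⟩ := hP (c + 1) (by omega) (hA _ h.1)
      intro x hx
      rcases Finset.mem_insert.1 hx with rfl | hx
      · exact h1
      rcases Finset.mem_insert.1 hx with rfl | hx
      · exact h2
      exact hA x hx
    · exact hA

/-- The invariant is that every element above the counter is already a sum of two others. The halves
inserted for `c + 1 ≥ 2` are at most `c`, so they never break it and are treated later in the same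
pass. -/
theorem isPairSum_halve (c : ℕ) (A : Finset ℕ) (h0 : 0 ∉ A)
    (hA : ∀ x ∈ A, c < x → 1 < x → IsPairSum A x) :
    ∀ x ∈ halve c A, 1 < x → IsPairSum (halve c A) x := by
  induction c generalizing A with
  | zero =>
    intro x hx h1
    exact hA x hx (by omega) h1
  | succ c ih =>
    rw [halve]
    split_ifs with h
    · obtain ⟨hmem, hne, -⟩ := h
      apply ih
      · simp only [Finset.mem_insert, not_or]
        refine ⟨by omega, by omega, h0⟩
      · intro x hx hcx h1
        have hsub : A ⊆ insert ((c + 1) / 2) (insert ((c + 2) / 2) A) :=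
          (Finset.subset_insert _ _).trans (Finset.subset_insert _ _)
        rcases eq_or_ne x (c + 1) with rfl | hxc
        · exact ⟨(c + 1) / 2, by simp, (c + 2) / 2, by simp, by omega, by omega, by omega⟩
        · have hxA : x ∈ A := by
            simp only [Finset.mem_insert] at hx
            rcases hx with hx | hx | hx
            · omega
            · omega
            · exact hx
          exact (hA x hxA (by omega) h1).mono hsub
    · apply ih _ h0
      intro x hx hcx h1
      rcases eq_or_ne x (c + 1) with rfl | hxc
      · by_contra hn
        exact h ⟨hx, by omega, hn⟩
      · exact hA x hx (by omega) h1

theorem isPairSum_additionSequence {E : Finset ℕ} (h0 : 0 ∉ E) {x : ℕ}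
    (hx : x ∈ additionSequence E) (h1 : 1 < x) : IsPairSum (additionSequence E) x := by
  refine isPairSum_halve _ _ h0 ?_ x hx h1
  intro y hy hlt
  have : y ≤ E.sup id := Finset.le_sup (f := id) hy
  omega

theorem subset_additionSequence (E : Finset ℕ) : E ⊆ additionSequence E := subset_halve _ _

theorem mem_additionSequence_bounds {E : Finset ℕ} {m : ℕ} (hE : ∀ x ∈ E, 0 < x ∧ x ≤ m) {x : ℕ}
    (hx : x ∈ additionSequence E) : 0 < x ∧ x ≤ m :=
  halve_induction (P := fun x => 0 < x ∧ x ≤ m) (fun x h2 h => by constructor <;> omega) _ _ hE x hx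

/-- The elements of the addition sequence are, up to `1`, quotients of elements of `E` by powers
of two. -/
theorem exists_of_mem_additionSequence {E : Finset ℕ} {x : ℕ} (hx : x ∈ additionSequence E) :
    ∃ e ∈ E, ∃ i, x = e / 2 ^ i ∨ x = e / 2 ^ i + 1 := by
  refine halve_induction (P := fun x => ∃ e ∈ E, ∃ i, x = e / 2 ^ i ∨ x = e / 2 ^ i + 1)
    ?_ _ _ (fun x hx => ⟨x, hx, 0, by simp⟩) x hx
  rintro x - ⟨e, he, i, h⟩
  refine ⟨⟨e, he, i + 1, ?_⟩, ⟨e, he, i + 1, ?_⟩⟩ <;>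
  · rw [pow_succ, ← Nat.div_div_eq_div_mul]
    generalize e / 2 ^ i = y at *
    omega

/-- An element above `1` has `e / 2 ^ i > 0`, which limits `i` to `Nat.log 2 m`; the factor `2`
counts the two possible roundings. -/
theorem card_additionSequence_le {E : Finset ℕ} {m : ℕ} (hE : ∀ x ∈ E, 0 < x ∧ x ≤ m) :
    ((additionSequence E).filter (fun c => 1 < c)).card ≤ E.card * (2 * (Nat.log 2 m + 1)) := by
  have hsub : (additionSequence E).filter (fun c => 1 < c) ⊆
      (E ×ˢ (Finset.range 2 ×ˢ Finset.range (Nat.log 2 m + 1))).image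
        (fun t => t.1 / 2 ^ t.2.2 + t.2.1) := by
    intro x hx
    obtain ⟨hxA, h1⟩ := Finset.mem_filter.1 hx
    obtain ⟨e, he, i, h⟩ := exists_of_mem_additionSequence hxA
    have hpos : 0 < e / 2 ^ i := by omega
    have hi : i < Nat.log 2 m + 1 := by
      have h2 : 2 ^ i ≤ e := (Nat.div_pos_iff.1 hpos).2
      have := Nat.le_log_of_pow_le (by norm_num) (h2.trans (hE e he).2)
      omega
    rw [Finset.mem_image]
    rcases h with h | h
    · exact ⟨(e, 0, i), by simp [he, hi], by simp [h]⟩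
    · exact ⟨(e, 1, i), by simp [he, hi], by simp [h]⟩
  refine (Finset.card_le_card hsub).trans (Finset.card_image_le.trans ?_)
  simp

/-- The search succeeds for a pair sum, so the default value `0` is never returned. -/
theorem summand_spec {A : Finset ℕ} {c : ℕ} (h : IsPairSum A c) :
    0 < summand A c ∧ summand A c < c ∧ summand A c ∈ A ∧ c - summand A c ∈ A := by
  obtain ⟨a, ha, b, hb, ha0, hb0, rfl⟩ := h
  unfold summand
  cases hf : (List.range (a + b)).find? (fun x => decide (0 < x ∧ x ∈ A ∧ a + b - x ∈ A)) with
  | none =>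
    rw [List.find?_eq_none] at hf
    have := hf a (by simp [hb0])
    simp [ha0, ha, hb] at this
  | some x =>
    have h1 := List.find?_some hf
    have h2 := List.mem_of_find?_eq_some hf
    simp at h1 h2
    exact ⟨h1.1, h2, h1.2⟩

/-! ### Correctness and cost of the algorithm -/

theorem mem_babyExponents_bounds {m : ℕ} (hm : 0 < m) (terms : List (ℤˣ × ℕ)) :
    ∀ x ∈ babyExponents m terms, 0 < x ∧ x ≤ m := by
  intro x hx
  simp only [babyExponents, Finset.mem_insert, Finset.mem_erase, List.mem_toFinset,
    List.mem_map] at hx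
  rcases hx with rfl | ⟨hx0, t, -, rfl⟩
  · exact ⟨hm, le_rfl⟩
  · exact ⟨by omega, (Nat.mod_lt _ hm).le⟩

theorem le_maxExponent {terms : List (ℤˣ × ℕ)} {t : ℤˣ × ℕ} (ht : t ∈ terms) :
    t.2 ≤ maxExponent terms := by
  induction terms with
  | nil => simp at ht
  | cons a l ih =>
    simp only [maxExponent, List.map_cons, List.foldr_cons, le_max_iff] at ih ⊢
    rcases List.mem_cons.1 ht with rfl | ht
    · exact Or.inl le_rfl
    · exact Or.inr (ih ht)

theorem maxExponent_le {terms : List (ℤˣ × ℕ)} {B : ℕ} (h : ∀ t ∈ terms, t.2 ≤ B) :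
    maxExponent terms ≤ B := by
  induction terms with
  | nil => simp [maxExponent]
  | cons a l ih =>
    simp only [maxExponent, List.map_cons, List.foldr_cons, max_le_iff] at ih ⊢
    exact ⟨h a (by simp), ih (fun t ht => h t (by simp [ht]))⟩

/-- The baby-step giant-step algorithm computes the sum of its terms. -/
theorem eval_bsgs {R : Type*} [Ring R] {m : ℕ} (hm : 0 < m) (terms : List (ℤˣ × ℕ)) (q : R) :
    (bsgs m terms).eval q = termSum q terms := by
  set A := additionSequence (babyExponents m terms) with hA
  have hE := mem_babyExponents_bounds hm terms
  have hE0 : 0 ∉ babyExponents m terms := fun h => by have := (hE 0 h).1; omega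
  set l := (A.sort (· ≤ ·)).filter (fun c => decide (1 < c)) with hl
  have hmem : ∀ x, x ∈ l ↔ x ∈ A ∧ 1 < x := by intro x; simp [hl]
  have hsorted : l.Pairwise (· < ·) := (Finset.sortedLT_sort A).pairwise.filter _
  -- After the first instruction registers `0` and `1` hold `q ^ 0` and `q ^ 1`, the only powers
  -- obtained without multiplication.
  set s : ℕ → R := Function.update (fun i : ℕ => if i = 1 then q else 0) 0 1 with hs
  have hs1 : ∀ a ∈ A, s a = q ^ a ∨ a ∈ l := by
    intro a ha
    by_cases h1 : 1 < a
    · exact Or.inr ((hmem a).2 ⟨ha, h1⟩)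
    · have : a = 1 := by
        have := (mem_additionSequence_bounds hE ha).1
        omega
      subst this
      left
      simp [hs]
  obtain ⟨hp1, hp2⟩ := foldl_powers q (summand A) l hsorted s (by
    intro x hx
    obtain ⟨hxA, h1⟩ := (hmem x).1 hx
    obtain ⟨g1, g2, g3, g4⟩ := summand_spec (isPairSum_additionSequence hE0 hxA h1)
    exact ⟨g2, Nat.sub_lt (by omega) g1, hs1 _ g3, hs1 _ g4⟩)
  have hcode : (bsgs m terms).code.foldl Instr.exec (fun i : ℕ => if i = 1 then q else 0) =
      (horner m terms (maxExponent terms / m)).foldl Instr.exec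
        ((l.map (fun c => Instr.mul c (summand A c) (c - summand A c))).foldl Instr.exec s) := by
    simp only [bsgs, List.cons_append, List.foldl_cons, List.foldl_append]
    rfl
  unfold Program.eval
  rw [hcode]
  rw [show (bsgs m terms).out = m + 1 from rfl]
  have hEA := subset_additionSequence (babyExponents m terms)
  have hnot : m + 1 ∉ l := by
    intro h
    have := (mem_additionSequence_bounds hE ((hmem _).1 h).1).2
    omega
  rw [foldl_horner q hm, hp2 _ hnot, sum_innerSum]
  · have : s (m + 1) = 0 := by
      simp [hs, Function.update_of_ne, hm.ne']
    rw [this, zero_mul, zero_add]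
  · intro t ht
    exact Nat.lt_succ_of_le (Nat.div_le_div_right (le_maxExponent ht))
  · exact hp1 m (hs1 m (hEA (by simp [babyExponents])))
  · intro t ht
    -- The residue `0` is not in the addition sequence; it is served by register `0`.
    by_cases hz : t.2 % m = 0
    · rw [hz]
      exact hp1 0 (Or.inl (by simp [hs]))
    · refine hp1 _ (hs1 _ (hEA ?_))
      simp only [babyExponents, Finset.mem_insert, Finset.mem_erase, List.mem_toFinset,
        List.mem_map]
      exact Or.inr ⟨hz, t, ht, rfl⟩

theorem muls_inner (m : ℕ) (terms : List (ℤˣ × ℕ)) (k : ℕ) :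
    ((inner m terms k).map Instr.muls).sum = 0 := by
  rw [List.sum_eq_zero]
  intro x hx
  simp only [inner, List.mem_map] at hx
  obtain ⟨i, ⟨t, -, rfl⟩, rfl⟩ := hx
  split_ifs <;> rfl

theorem muls_horner (m : ℕ) (terms : List (ℤˣ × ℕ)) (k : ℕ) :
    ((horner m terms k).map Instr.muls).sum = k := by
  induction k with
  | zero => simp [horner, muls_inner]
  | succ k ih => simp [horner, muls_inner, ih, Instr.muls, add_comm]

theorem muls_powers (A : Finset ℕ) :
    ((powers A).map Instr.muls).sum = (A.filter (fun c => 1 < c)).card := by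
  have : (powers A).map Instr.muls =
      ((A.sort (· ≤ ·)).filter (fun c => decide (1 < c))).map (fun _ => 1) := by
    simp [powers, Instr.muls, Function.comp_def]
  rw [this, List.map_const', List.sum_replicate, smul_eq_mul, mul_one]
  have h2 : (A.filter (fun c => 1 < c)) =
      ((A.sort (· ≤ ·)).filter (fun c => decide (1 < c))).toFinset := by
    ext x; simp
  rw [h2, List.toFinset_card_of_nodup ((Finset.sort_nodup A _).filter _)]

theorem muls_bsgs_le {m : ℕ} (hm : 0 < m) (terms : List (ℤˣ × ℕ)) :
    (bsgs m terms).muls ≤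
      ((terms.map (fun t => t.2 % m)).toFinset.card + 1) * (2 * (Nat.log 2 m + 1)) +
        maxExponent terms / m := by
  have h1 : (bsgs m terms).muls =
      ((additionSequence (babyExponents m terms)).filter (fun c => 1 < c)).card +
        maxExponent terms / m := by
    simp [Program.muls, bsgs, muls_horner, muls_powers, Instr.muls]
  rw [h1]
  gcongr
  refine (card_additionSequence_le (mem_babyExponents_bounds hm terms)).trans ?_
  gcongr
  exact (Finset.card_insert_le _ _).trans
    (Nat.add_le_add_right (Finset.card_le_card (Finset.erase_subset _ _)) 1)

end BSGS
-- Values of a quadratic polynomial modulo suitable primes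
namespace BSGS

theorem SuitablePrime.two_lt {F : Polynomial ℚ} {p : ℕ} (hp : SuitablePrime F p) : 2 < p :=
  lt_of_le_of_ne hp.1.two_le (Ne.symm hp.2.1)

/-- All primes but finitely many are suitable. -/
theorem exists_bound_suitablePrime {F : Polynomial ℚ} (hF : F ≠ 0) :
    ∃ B : ℕ, ∀ p : ℕ, p.Prime → B < p → SuitablePrime F p := by
  -- A prime above this number exceeds each integer it must not divide; coefficients outside the
  -- support have denominator `1`.
  refine ⟨2 + F.leadingCoeff.num.natAbs + ∑ i ∈ F.support, (F.coeff i).den, fun p hp hB => ?_⟩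
  refine ⟨hp, by omega, fun h => ?_, fun i h => ?_⟩
  · have hne : F.leadingCoeff.num.natAbs ≠ 0 := by simpa using hF
    have := Nat.le_of_dvd (Nat.pos_of_ne_zero hne) (Int.natCast_dvd.1 h)
    omega
  · have h1 := Nat.le_of_dvd (F.coeff i).den_pos h
    by_cases hi : i ∈ F.support
    · have := Finset.single_le_sum (f := fun i => (F.coeff i).den) (fun _ _ => Nat.zero_le _) hi
      omega
    · rw [Polynomial.notMem_support_iff.1 hi] at h1
      have := hp.two_le
      simp at h1
      omega

theorem infinite_suitablePrime {F : Polynomial ℚ} (hF : F ≠ 0) :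
    (Set.ofPred (SuitablePrime F)).Infinite := by
  obtain ⟨B, hB⟩ := exists_bound_suitablePrime hF
  refine Set.infinite_of_not_bddAbove ?_
  rintro ⟨M, hM⟩
  obtain ⟨p, hp, hprime⟩ := Nat.exists_infinite_primes (max B M + 1)
  have := hM (show p ∈ Set.ofPred (SuitablePrime F) from hB p hprime (by omega))
  omega

theorem nth_suitablePrime {F : Polynomial ℚ} (hF : F ≠ 0) (i : ℕ) :
    SuitablePrime F (Nat.nth (SuitablePrime F) i) :=
  Nat.nth_mem_of_infinite (infinite_suitablePrime hF) i

theorem modulus_succ (F : Polynomial ℚ) (k : ℕ) :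
    modulus F (k + 1) = modulus F k * Nat.nth (SuitablePrime F) k :=
  Finset.prod_range_succ _ _

theorem coprime_modulus {F : Polynomial ℚ} (hF : F ≠ 0) (k : ℕ) :
    Nat.Coprime (modulus F k) (Nat.nth (SuitablePrime F) k) := by
  refine Nat.Coprime.prod_left fun i hi => ?_
  rw [Nat.coprime_primes (nth_suitablePrime hF i).1 (nth_suitablePrime hF k).1]
  exact ((Nat.nth_strictMono (infinite_suitablePrime hF)) (Finset.mem_range.1 hi)).ne

theorem modulus_pos {F : Polynomial ℚ} (hF : F ≠ 0) (k : ℕ) : 0 < modulus F k :=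
  Finset.prod_pos fun i _ => (nth_suitablePrime hF i).1.pos

theorem eval_eq_of_natDegree_two {F : Polynomial ℚ} (hF : F.natDegree = 2) (x : ℚ) :
    F.eval x = F.coeff 2 * x ^ 2 + F.coeff 1 * x + F.coeff 0 := by
  rw [Polynomial.eval_eq_sum_range, hF]
  simp [Finset.sum_range_succ]
  ring

/-- A quadratic polynomial takes at most `(p + 1) / 2` values modulo a suitable prime `p`. -/
theorem card_image_mod_prime_le {F : Polynomial ℚ} (hF : F.natDegree = 2) {p : ℕ}
    (hp : SuitablePrime F p) (V : Finset ℕ)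
    (hV : ∀ v ∈ V, ∃ n : ℤ, (v : ℚ) = F.eval (n : ℚ)) :
    (V.image (fun v => v % p)).card ≤ p / 2 + 1 := by
  obtain ⟨hprime, hp2, hlead, hden⟩ := hp
  have : Fact p.Prime := ⟨hprime⟩
  rw [Polynomial.leadingCoeff, hF] at hlead
  set a := F.coeff 2 with ha
  set b := F.coeff 1 with hb
  set c := F.coeff 0 with hc
  have hcast : ∀ i, ((F.coeff i).den : ZMod p) ≠ 0 := fun i h =>
    hden i ((ZMod.natCast_eq_zero_iff _ _).1 h)
  have hnum : ((a.num : ℤ) : ZMod p) ≠ 0 := fun h =>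
    hlead ((ZMod.intCast_zmod_eq_zero_iff_dvd _ _).1 h)
  have htwo : (2 : ZMod p) ≠ 0 := by
    intro h
    have h' : ((2 : ℕ) : ZMod p) = 0 := by exact_mod_cast h
    rw [ZMod.natCast_eq_zero_iff] at h'
    exact hp2 ((Nat.prime_dvd_prime_iff_eq hprime Nat.prime_two).1 h')
  -- Clearing denominators: `D * F(n) = A * n ^ 2 + B * n + C` in `ZMod p`, with `A` and `D`
  -- invertible.
  set A : ZMod p := a.num * b.den * c.den with hA
  set B : ZMod p := b.num * a.den * c.den with hB
  set C : ZMod p := c.num * a.den * b.den with hC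
  set D : ZMod p := a.den * b.den * c.den with hD
  have hA0 : A ≠ 0 := mul_ne_zero (mul_ne_zero hnum (hcast 1)) (hcast 0)
  have hD0 : D ≠ 0 := mul_ne_zero (mul_ne_zero (hcast 2) (hcast 1)) (hcast 0)
  have h4 : 4 * A * D ≠ 0 := by
    have : (4 : ZMod p) = 2 * 2 := by norm_num
    rw [this]
    exact mul_ne_zero (mul_ne_zero (mul_ne_zero htwo htwo) hA0) hD0
  -- With `y = 2 * A * n + B` one has `4 * A * D * v = y ^ 2 + (4 * A * C - B ^ 2)`. Only `y ^ 2`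
  -- matters, so `y` may be replaced by its least absolute residue `j ≤ p / 2`.
  have hsub : V.image (fun v => v % p) ⊆ (Finset.range (p / 2 + 1)).image
      (fun j : ℕ => (((j : ZMod p) ^ 2 + (4 * A * C - B ^ 2)) / (4 * A * D)).val) := by
    intro x hx
    obtain ⟨v, hv, rfl⟩ := Finset.mem_image.1 hx
    obtain ⟨n, hn⟩ := hV v hv
    rw [eval_eq_of_natDegree_two hF, ← ha, ← hb, ← hc] at hn
    have hZ : (a.den * b.den * c.den * v : ℤ) = a.num * b.den * c.den * n ^ 2 +
        b.num * a.den * c.den * n + c.num * a.den * b.den := by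
      have h1 : (a.den : ℚ) * a = a.num := Rat.den_mul_eq_num a
      have h2 : (b.den : ℚ) * b = b.num := Rat.den_mul_eq_num b
      have h3 : (c.den : ℚ) * c = c.num := Rat.den_mul_eq_num c
      have : (a.den * b.den * c.den * v : ℚ) = a.num * b.den * c.den * n ^ 2 +
        b.num * a.den * c.den * n + c.num * a.den * b.den := by
        rw [← h1, ← h2, ← h3, hn]; ring
      exact_mod_cast this
    have hP : D * (v : ZMod p) = A * (n : ZMod p) ^ 2 + B * n + C := by
      have := congrArg (Int.cast : ℤ → ZMod p) hZ
      push_cast at this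
      rw [hD, hA, hB, hC, this]
    set y : ZMod p := 2 * A * n + B with hy
    have hsq : ((y.valMinAbs.natAbs : ℕ) : ZMod p) ^ 2 = y ^ 2 := by
      have : (((y.valMinAbs.natAbs : ℕ) : ℤ) : ZMod p) ^ 2 = y ^ 2 := by
        rw [← Int.cast_pow, Int.natAbs_sq, Int.cast_pow, ZMod.coe_valMinAbs]
      exact_mod_cast this
    refine Finset.mem_image.2 ⟨y.valMinAbs.natAbs, ?_, ?_⟩
    · exact Finset.mem_range.2 (Nat.lt_succ_of_le (ZMod.natAbs_valMinAbs_le y))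
    · rw [hsq, ← ZMod.val_natCast]
      congr 1
      rw [div_eq_iff h4, hy]
      linear_combination (-4 * A) * hP
  refine (Finset.card_le_card hsub).trans (Finset.card_image_le.trans ?_)
  simp

/-- By the Chinese remainder theorem, a quadratic polynomial takes few values modulo a product of
suitable primes. -/
theorem card_image_mod_modulus_le {F : Polynomial ℚ} (hF : F.natDegree = 2) (V : Finset ℕ)
    (hV : ∀ v ∈ V, ∃ n : ℤ, (v : ℚ) = F.eval (n : ℚ)) (k : ℕ) :
    2 ^ k * (V.image (fun v => v % modulus F k)).card ≤ (k + 1) * modulus F k := by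
  have hF0 : F ≠ 0 := by rintro rfl; simp at hF
  induction k with
  | zero =>
    have : V.image (fun v => v % modulus F 0) ⊆ {0} := by
      intro x hx
      obtain ⟨v, -, rfl⟩ := Finset.mem_image.1 hx
      simp [modulus, Nat.mod_one]
    simpa [modulus] using Finset.card_le_card this
  | succ k ih =>
    set p := Nat.nth (SuitablePrime F) k with hp
    have hps : SuitablePrime F p := nth_suitablePrime hF0 k
    -- This is exactly what `(k + 1) * (p + 1) ≤ (k + 2) * p` needs, so the product of the factors
    -- `1 + 1 / p` telescopes to at most `k + 1`.
    have hkp : k + 1 ≤ p := by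
      have h0 : 2 < Nat.nth (SuitablePrime F) 0 := (nth_suitablePrime hF0 0).two_lt
      have := (Nat.nth_strictMono (infinite_suitablePrime hF0)).add_le_nat k 0
      simp only [add_zero] at this
      omega
    have hodd : 2 * (p / 2 + 1) = p + 1 := by
      have := hps.1.eq_two_or_odd.resolve_left hps.2.1
      omega
    have hcard : (V.image (fun v => v % modulus F (k + 1))).card ≤
        (V.image (fun v => v % modulus F k)).card * (V.image (fun v => v % p)).card := by
      rw [← Finset.card_product]
      refine Finset.card_le_card_of_injOn (fun x => (x % modulus F k, x % p)) ?_ ?_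
      · intro x hx
        obtain ⟨v, hv, rfl⟩ := Finset.mem_image.1 (Finset.mem_coe.1 hx)
        rw [modulus_succ, ← hp]
        simp only [Finset.coe_product, Set.mem_prod, Finset.mem_coe]
        refine ⟨Finset.mem_image.2 ⟨v, hv, ?_⟩, Finset.mem_image.2 ⟨v, hv, ?_⟩⟩
        · exact (Nat.mod_mul_right_mod _ _ _).symm
        · exact (Nat.mod_mul_left_mod _ _ _).symm
      · intro x hx y hy hxy
        obtain ⟨v, -, rfl⟩ := Finset.mem_image.1 (Finset.mem_coe.1 hx)
        obtain ⟨w, -, rfl⟩ := Finset.mem_image.1 (Finset.mem_coe.1 hy)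
        simp only [Prod.mk.injEq] at hxy
        have := (Nat.modEq_and_modEq_iff_modEq_mul (coprime_modulus hF0 k)).1 hxy
        rw [← modulus_succ] at this
        simpa [Nat.ModEq] using this
    calc 2 ^ (k + 1) * (V.image (fun v => v % modulus F (k + 1))).card
        ≤ 2 ^ (k + 1) * ((V.image (fun v => v % modulus F k)).card * (p / 2 + 1)) := by
          gcongr
          exact hcard.trans (Nat.mul_le_mul_left _ (card_image_mod_prime_le hF hps V hV))
      _ = 2 ^ k * (V.image (fun v => v % modulus F k)).card * (2 * (p / 2 + 1)) := by ring
      _ ≤ (k + 1) * modulus F k * (p + 1) := by rw [hodd]; gcongr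
      _ = modulus F k * ((k + 1) * (p + 1)) := by ring
      _ ≤ modulus F k * ((k + 1 + 1) * p) := Nat.mul_le_mul_left _ (by nlinarith)
      _ = (k + 1 + 1) * modulus F (k + 1) := by rw [modulus_succ]; ring

/-- The suitable primes grow at most quadratically. -/
theorem eventually_nth_suitablePrime_lt {F : Polynomial ℚ} (hF : F ≠ 0) :
    ∀ᶠ k : ℕ in Filter.atTop, Nat.nth (SuitablePrime F) k < (k + 1) ^ 2 := by
  classical
  obtain ⟨B, hB⟩ := exists_bound_suitablePrime hF
  have hcount : ∀ n, Nat.primeCounting n ≤ Nat.count (SuitablePrime F) (n + 1) + (B + 1) := by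
    intro n
    rw [Nat.primeCounting, Nat.primeCounting', Nat.count_eq_card_filter_range,
      Nat.count_eq_card_filter_range]
    calc _ ≤ ((Finset.range (n + 1)).filter (SuitablePrime F) ∪ Finset.range (B + 1)).card := by
          refine Finset.card_le_card fun p hp => ?_
          obtain ⟨h1, h2⟩ := Finset.mem_filter.1 hp
          by_cases hpB : B < p
          · exact Finset.mem_union_left _ (Finset.mem_filter.2 ⟨h1, hB p h2 hpB⟩)
          · exact Finset.mem_union_right _ (Finset.mem_range.2 (by omega))
      _ ≤ _ := by
          refine (Finset.card_union_le _ _).trans ?_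
          simp
  -- Here `n ^ 2 + 2 * n = (n + 1) ^ 2 - 1`: more than `n + B + 1` primes lie below `(n + 1) ^ 2`,
  -- and at most `B + 1` of them are unsuitable. Chebyshev's lower bound gives far more.
  have hpi : ∀ᶠ n : ℕ in Filter.atTop,
      (n : ℝ) + 1 + (B + 1) ≤ Nat.primeCounting (n ^ 2 + 2 * n) := by
    have hlog := Real.isLittleO_log_id_atTop.bound (show (0 : ℝ) < 1 / 100 by norm_num)
    filter_upwards [(tendsto_natCast_atTop_atTop (R := ℝ)).eventually
        ((Filter.tendsto_atTop_add_const_right _ 1 Filter.tendsto_id).eventually hlog),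
      Filter.eventually_ge_atTop (B + 100)] with n hn hnB
    have hge := Chebyshev.pi_ge (n ^ 2 + 2 * n)
    refine le_trans ?_ hge
    simp only [id, Real.norm_eq_abs] at hn
    have hn0 : (B : ℝ) + 100 ≤ n := by exact_mod_cast hnB
    have hB0 : (0 : ℝ) ≤ B := Nat.cast_nonneg _
    have hL0 : 0 ≤ Real.log ((n : ℝ) + 1) := Real.log_nonneg (by linarith)
    rw [abs_of_nonneg hL0, abs_of_nonneg (by linarith)] at hn
    have h1 : Real.log (((n ^ 2 + 2 * n : ℕ) : ℝ) + 1) = 2 * Real.log (n + 1) := by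
      rw [← Real.log_rpow (by positivity), Real.rpow_two]; push_cast; congr 1; ring
    have h2 : Real.log ((n ^ 2 + 2 * n : ℕ) : ℝ) ≤ 2 * Real.log (n + 1) := by
      rw [← h1]
      exact Real.log_le_log (by push_cast; nlinarith) (by linarith)
    have h3 : 0 < Real.log ((n ^ 2 + 2 * n : ℕ) : ℝ) :=
      Real.log_pos (by push_cast; nlinarith)
    rw [le_div_iff₀ h3, h1]
    have hl2 := Real.log_two_gt_d9
    push_cast
    have h4 : ((n : ℝ) + 1 + (B + 1)) * Real.log ((n ^ 2 + 2 * n : ℕ) : ℝ) ≤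
        (2 * n) * (2 * (1 / 100 * (n + 1))) := by
      apply mul_le_mul (by linarith) (h2.trans (by linarith)) h3.le (by positivity)
    push_cast at h4
    nlinarith
  filter_upwards [hpi] with n hn
  apply Nat.nth_lt_of_lt_count
  have h5 := hcount (n ^ 2 + 2 * n)
  have h6 : n + 1 + (B + 1) ≤ Nat.primeCounting (n ^ 2 + 2 * n) := by exact_mod_cast hn
  have h7 : n ^ 2 + 2 * n + 1 = (n + 1) ^ 2 := by ring
  rw [h7] at h5
  omega

end BSGS
-- Balancing the two phases and the asymptotic bound
namespace BSGS

theorem three_pow_le_modulus {F : Polynomial ℚ} (hF : F ≠ 0) (k : ℕ) : 3 ^ k ≤ modulus F k := by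
  simpa [modulus] using Finset.pow_card_le_prod (Finset.range k)
    (fun i => Nat.nth (SuitablePrime F) i) 3 fun i _ => (nth_suitablePrime hF i).two_lt

theorem modulus_mono {F : Polynomial ℚ} (hF : F ≠ 0) : Monotone (modulus F) := by
  refine monotone_nat_of_le_succ fun k => ?_
  rw [modulus_succ]
  exact Nat.le_mul_of_pos_right _ (nth_suitablePrime hF k).1.pos

theorem modulus_succ_le {F : Polynomial ℚ} (hF : F ≠ 0) {j : ℕ}
    (hj : Nat.nth (SuitablePrime F) j < (j + 1) ^ 2) :
    modulus F (j + 1) ≤ ((j + 1) ^ 2) ^ (j + 1) := by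
  refine (Finset.prod_le_pow_card _ _ ((j + 1) ^ 2) fun i hi => ?_).trans (by simp)
  have := Nat.nth_monotone (infinite_suitablePrime hF) (Nat.lt_succ_iff.1 (Finset.mem_range.1 hi))
  exact this.trans hj.le

/-- The number of primes in the splitting parameter can be chosen such that the baby-steps and
the giant-steps are balanced. -/
theorem exists_balanced {F : Polynomial ℚ} (hF : F ≠ 0) (K : ℕ) :
    ∀ᶠ N : ℕ in Filter.atTop, ∃ j, K ≤ j ∧ modulus F j ^ 2 < N ^ 2 * 2 ^ j ∧
      N ^ 2 * 2 ^ (j + 1) ≤ modulus F (j + 1) ^ 2 := by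
  classical
  filter_upwards [Filter.eventually_gt_atTop (modulus F K)] with N hN
  -- The condition `modulus F k ≥ N * √2 ^ k`, squared to stay in `ℕ`. It holds at `k = N` because
  -- `8 ^ N ≤ 9 ^ N`.
  have hex : ∃ k, N ^ 2 * 2 ^ k ≤ modulus F k ^ 2 := by
    refine ⟨N, ?_⟩
    calc N ^ 2 * 2 ^ N ≤ (2 ^ N) ^ 2 * 2 ^ N := by
          gcongr
          exact Nat.lt_two_pow_self.le
      _ = 8 ^ N := by rw [← pow_mul, mul_comm N 2, pow_mul, ← mul_pow]; norm_num
      _ ≤ 9 ^ N := Nat.pow_le_pow_left (by norm_num) N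
      _ = (3 ^ N) ^ 2 := by rw [← pow_mul, mul_comm N 2, pow_mul]; norm_num
      _ ≤ _ := Nat.pow_le_pow_left (three_pow_le_modulus hF N) 2
  -- As `N` exceeds `modulus F K`, no index up to `K` qualifies; hence `k` grows with `N`.
  have hlt : K < Nat.find hex := by
    rw [Nat.lt_find_iff]
    intro j hj h
    have h1 : modulus F j ^ 2 < N ^ 2 :=
      Nat.pow_lt_pow_left ((modulus_mono hF hj).trans_lt hN) (by norm_num)
    have h2 : N ^ 2 * 1 ≤ N ^ 2 * 2 ^ j := Nat.mul_le_mul_left _ Nat.one_le_two_pow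
    omega
  obtain ⟨j, hj⟩ : ∃ j, Nat.find hex = j + 1 := ⟨Nat.find hex - 1, by omega⟩
  refine ⟨j, by omega, ?_, ?_⟩
  · exact not_le.1 (Nat.find_min hex (by omega))
  · rw [← hj]
    exact Nat.find_spec hex

/-- The number of multiplications for a balanced splitting parameter. -/
theorem muls_bsgs_le_of_balanced {F : Polynomial ℚ} (hF : F.natDegree = 2) {j N : ℕ}
    (hj : Nat.nth (SuitablePrime F) j < (j + 1) ^ 2)
    (hlt : modulus F j ^ 2 < N ^ 2 * 2 ^ j) (hge : N ^ 2 * 2 ^ (j + 1) ≤ modulus F (j + 1) ^ 2)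
    {C : ℝ} (hC : 0 ≤ C) (terms : List (ℤˣ × ℕ))
    (hterms : ∀ t ∈ terms, (∃ n : ℤ, (t.2 : ℚ) = F.eval (n : ℚ)) ∧ (t.2 : ℝ) ≤ C * N ^ 2) :
    ((bsgs (modulus F (j + 1)) terms).muls : ℝ) ≤
      N * ((24 + C) * ((j + 1 : ℕ) : ℝ) ^ 5 / √2 ^ (j + 1)) := by
  have hF0 : F ≠ 0 := by rintro rfl; simp at hF
  set k := j + 1 with hk
  set m := modulus F k with hm
  have hm0 : 0 < m := modulus_pos hF0 k
  set r : ℝ := √2 with hr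
  have hr0 : 0 < r := by positivity
  have hr1 : 1 ≤ r := Real.one_le_sqrt.2 (by norm_num)
  have hr2 : r ^ 2 = 2 := Real.sq_sqrt (by norm_num)
  have hrk : ∀ i, (2 : ℝ) ^ i = (r ^ i) ^ 2 := fun i => by rw [← hr2]; ring
  have hk1 : (1 : ℝ) ≤ k := by rw [hk]; push_cast; linarith [Nat.cast_nonneg (α := ℝ) j]
  have hupper : (m : ℝ) ≤ N * r ^ k * k ^ 2 := by
    have h1 : (modulus F j : ℝ) ≤ N * r ^ j := by
      refine (sq_le_sq₀ (by positivity) (by positivity)).1 ?_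
      rw [mul_pow, ← hrk]
      exact_mod_cast hlt.le
    have h2 : (m : ℝ) = modulus F j * Nat.nth (SuitablePrime F) j := by
      rw [hm, hk, modulus_succ]; push_cast; ring
    rw [h2]
    have h3 : (Nat.nth (SuitablePrime F) j : ℝ) ≤ k ^ 2 := by exact_mod_cast hj.le
    have h4 : r ^ j ≤ r ^ k := pow_le_pow_right₀ hr1 (by omega)
    calc _ ≤ (N * r ^ j) * (k : ℝ) ^ 2 := by gcongr
      _ ≤ _ := by gcongr
  have hlower : N * r ^ k ≤ m := by
    refine (sq_le_sq₀ (by positivity) (by positivity)).1 ?_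
    rw [mul_pow, ← hrk]
    exact_mod_cast hge
  have hlog : Nat.log 2 m ≤ 2 * k ^ 2 := by
    have h1 : m ≤ 2 ^ (2 * k ^ 2) := by
      calc m ≤ (k ^ 2) ^ k := modulus_succ_le hF0 hj
        _ ≤ ((2 ^ k) ^ 2) ^ k := by gcongr; exact Nat.lt_two_pow_self.le
        _ = 2 ^ (2 * k ^ 2) := by rw [← pow_mul, ← pow_mul]; congr 1; ring
    exact (Nat.log_mono_right h1).trans (by rw [Nat.log_pow (by norm_num)])
  have hcard : ((terms.map (fun t => t.2 % m)).toFinset.card : ℝ) ≤ (k + 1) * m / 2 ^ k := by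
    have h1 : (terms.map (fun t => t.2 % m)).toFinset =
        (terms.map Prod.snd).toFinset.image (fun v => v % m) := by
      ext x; aesop
    have h2 := card_image_mod_modulus_le hF (terms.map Prod.snd).toFinset (by
      intro v hv
      simp only [List.mem_toFinset, List.mem_map] at hv
      obtain ⟨t, ht, rfl⟩ := hv
      exact (hterms t ht).1) k
    rw [h1, le_div_iff₀ (by positivity), mul_comm]
    exact_mod_cast h2
  -- Absorbs the extra baby-step exponent `m` at the price of a factor `2`.
  have hone : (1 : ℝ) ≤ (k + 1) * m / 2 ^ k := by
    rw [le_div_iff₀ (by positivity), one_mul]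
    have h1 : (2 : ℝ) ^ k ≤ m := by
      exact_mod_cast (Nat.pow_le_pow_left (by norm_num) k).trans (three_pow_le_modulus hF0 k)
    nlinarith
  have hbaby : (k + 1) * (m : ℝ) / 2 ^ k ≤ (k + 1) * (N * k ^ 2 / r ^ k) := by
    rw [mul_div_assoc]
    refine mul_le_mul_of_nonneg_left ?_ (by positivity)
    rw [div_le_div_iff₀ (by positivity) (by positivity), hrk]
    calc (m : ℝ) * r ^ k ≤ N * r ^ k * k ^ 2 * r ^ k := by gcongr
      _ = _ := by ring
  have hgiant : ((maxExponent terms / m : ℕ) : ℝ) ≤ C * N / r ^ k := by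
    refine Nat.cast_div_le.trans ?_
    have hT : (maxExponent terms : ℝ) ≤ C * N ^ 2 := by
      have : maxExponent terms ≤ ⌊C * N ^ 2⌋₊ :=
        maxExponent_le fun t ht => Nat.le_floor (hterms t ht).2
      exact (Nat.le_floor_iff (by positivity)).1 this
    rw [div_le_div_iff₀ (by positivity) (by positivity)]
    calc (maxExponent terms : ℝ) * r ^ k ≤ C * N ^ 2 * r ^ k := by gcongr
      _ = C * N * (N * r ^ k) := by ring
      _ ≤ C * N * m := by gcongr
  have hmuls : ((bsgs m terms).muls : ℝ) ≤
      ((terms.map (fun t => t.2 % m)).toFinset.card + 1) * (2 * (Nat.log 2 m + 1)) +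
        (maxExponent terms / m : ℕ) := by
    exact_mod_cast muls_bsgs_le hm0 terms
  have hlog' : (Nat.log 2 m : ℝ) ≤ 2 * k ^ 2 := by exact_mod_cast hlog
  have hk2 : (1 : ℝ) ≤ (k : ℝ) ^ 2 := one_le_pow₀ hk1
  calc ((bsgs m terms).muls : ℝ) ≤ _ := hmuls
    _ ≤ (2 * ((2 * k) * (N * k ^ 2 / r ^ k))) * (2 * (3 * k ^ 2)) + C * N / r ^ k := by
        have h1 : (k + 1) * (N * (k : ℝ) ^ 2 / r ^ k) ≤ (2 * k) * (N * k ^ 2 / r ^ k) := by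
          gcongr; linarith
        gcongr
        · linarith
        · linarith
    _ = N * ((24 * (k : ℝ) ^ 5 + C) / r ^ k) := by ring
    _ ≤ N * ((24 + C) * (k : ℝ) ^ 5 / r ^ k) := by
        gcongr
        have h5 : (1 : ℝ) ≤ (k : ℝ) ^ 5 := one_le_pow₀ hk1
        nlinarith

/-- Since `log 2 / 2 > 1/4 + 9/100`, a factor `exp (9/100 * k)` is left over to beat `C * k ^ 5`. -/
theorem eventually_mul_pow_div_lt (C : ℝ) :
    ∀ᶠ k : ℕ in Filter.atTop, C * (k : ℝ) ^ 5 / √2 ^ k < Real.exp (-((k : ℝ) / 4)) := by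
  have h := (isLittleO_pow_exp_pos_mul_atTop 5 (show (0 : ℝ) < 9 / 100 by norm_num)).bound
    (show (0 : ℝ) < 1 / (2 * (|C| + 1)) by positivity)
  filter_upwards [(tendsto_natCast_atTop_atTop (R := ℝ)).eventually h] with k hk
  simp only [Real.norm_eq_abs, Real.abs_exp] at hk
  rw [abs_of_nonneg (by positivity : (0 : ℝ) ≤ (k : ℝ) ^ 5)] at hk
  have hC : 0 < |C| + 1 := by positivity
  have h1 : √2 ^ k = Real.exp (Real.log 2 / 2 * k) := by
    rw [Real.sqrt_eq_rpow, Real.rpow_def_of_pos (by norm_num), ← Real.exp_nat_mul]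
    congr 1; ring
  rw [div_lt_iff₀ (by positivity), h1, ← Real.exp_add]
  have hl := Real.log_two_gt_d9
  have hk0 : (0 : ℝ) ≤ k := Nat.cast_nonneg k
  calc C * (k : ℝ) ^ 5 ≤ (|C| + 1) * (k : ℝ) ^ 5 := by
        gcongr; linarith [le_abs_self C]
    _ ≤ (|C| + 1) * (1 / (2 * (|C| + 1)) * Real.exp (9 / 100 * k)) := by gcongr
    _ = Real.exp (9 / 100 * k) / 2 := by field_simp
    _ < Real.exp (9 / 100 * k) := half_lt_self (Real.exp_pos _)
    _ ≤ _ := Real.exp_le_exp.2 (by nlinarith)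

theorem bound_eq_mul_exp (c : ℝ) {N : ℕ} (hN : 0 < N) :
    bound c N = N * Real.exp (-(c * (Real.log N / Real.log (Real.log N)))) := by
  have hN' : (0 : ℝ) < N := by exact_mod_cast hN
  rw [bound, sub_eq_add_neg, Real.rpow_add hN', Real.rpow_one, Real.rpow_def_of_pos hN']
  congr 2
  ring

/-- The function `x / log x` increases from `e` on, and `log N ≤ x` for `x = 2 * k * log k`. Since
`log k ≥ 1/2`, `x ≥ k`, whence `x / log x ≤ x / log k = 2 * k`. -/
theorem log_div_log_log_le {N k : ℕ} (hk : 2 ≤ k) (hN : Real.exp 1 ≤ Real.log N)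
    (h : N ≤ (k ^ 2) ^ k) : Real.log N / Real.log (Real.log N) ≤ 2 * k := by
  have hk' : (2 : ℝ) ≤ k := by exact_mod_cast hk
  have hlk : 1 / 2 ≤ Real.log k := by
    have := Real.log_le_log (by norm_num) hk'
    linarith [Real.log_two_gt_d9]
  have he : 1 ≤ Real.exp 1 := Real.one_le_exp (by norm_num)
  have hN0 : (0 : ℝ) < N := by
    rcases Nat.eq_zero_or_pos N with rfl | h0
    · simp at hN; linarith
    · exact_mod_cast h0
  have h1 : Real.log N ≤ 2 * k * Real.log k := by
    calc Real.log N ≤ Real.log (((k ^ 2) ^ k : ℕ) : ℝ) := Real.log_le_log hN0 (by exact_mod_cast h)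
      _ = 2 * k * Real.log k := by push_cast; rw [Real.log_pow, Real.log_pow]; push_cast; ring
  have hanti := Real.log_div_self_antitoneOn (a := Real.log N) (b := 2 * k * Real.log k)
    hN (hN.trans h1) h1
  simp only at hanti
  have hlog2 : Real.log k ≤ Real.log (2 * k * Real.log k) :=
    Real.log_le_log (by linarith) (by nlinarith)
  have hll : 0 < Real.log (Real.log N) :=
    Real.log_pos (lt_of_lt_of_le (by simp) hN)
  have hLpos : 0 < Real.log N := by linarith
  rw [div_le_iff₀ hll]
  have h2 : 1 / (2 * k : ℝ) ≤ Real.log (2 * k * Real.log k) / (2 * k * Real.log k) := by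
    rw [div_le_div_iff₀ (by positivity) (by positivity)]
    nlinarith
  have h3 := h2.trans hanti
  rw [div_le_div_iff₀ (by positivity) hLpos] at h3
  linarith

/-- For a suitable splitting parameter the algorithm evaluates every sum over exponents
represented by `F` with few multiplications. -/
theorem eventually_exists_muls_lt {F : Polynomial ℚ} (hF : F.natDegree = 2) :
    ∀ᶠ N : ℕ in Filter.atTop, ∃ k : ℕ, ∀ terms : List (ℤˣ × ℕ),
      (∀ t ∈ terms, ∃ n : ℤ, n.natAbs ≤ N ∧ (t.2 : ℚ) = F.eval (n : ℚ)) →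
      ((bsgs (modulus F k) terms).muls : ℝ) < bound (1 / 8) N ∧
      ∀ (R : Type u) [Ring R] (q : R), (bsgs (modulus F k) terms).eval q = termSum q terms := by
  have hF0 : F ≠ 0 := by rintro rfl; simp at hF
  -- Bounds `F(n)` by `c * N ^ 2` for all `|n| ≤ N`, negative `n` included, as the series of `η`
  -- requires.
  set c : ℚ := |F.coeff 2| + |F.coeff 1| + |F.coeff 0| with hc
  have hc0 : 0 ≤ c := by positivity
  obtain ⟨K₁, hK₁⟩ := Filter.eventually_atTop.1 (eventually_nth_suitablePrime_lt hF0)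
  obtain ⟨K₂, hK₂⟩ := Filter.eventually_atTop.1 (eventually_mul_pow_div_lt (24 + c))
  filter_upwards [exists_balanced hF0 (K₁ + K₂ + 2), Filter.eventually_ge_atTop 1,
    (Real.tendsto_log_atTop.comp (tendsto_natCast_atTop_atTop (R := ℝ))).eventually_ge_atTop
      (Real.exp 1)] with N ⟨j, hKj, hlt, hge⟩ hN1 hN
  refine ⟨j + 1, fun terms hterms => ⟨?_, fun R _ q => eval_bsgs (modulus_pos hF0 _) terms q⟩⟩
  have hj := hK₁ j (by omega)
  have hN0 : (0 : ℝ) < N := by exact_mod_cast hN1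
  refine (muls_bsgs_le_of_balanced hF hj hlt hge (C := (c : ℝ)) (by exact_mod_cast hc0) terms
    ?_).trans_lt ?_
  · intro t ht
    obtain ⟨n, hn, hv⟩ := hterms t ht
    refine ⟨⟨n, hv⟩, ?_⟩
    have hnN : |(n : ℚ)| ≤ N := by
      rw [← Int.cast_abs, Int.abs_eq_natAbs]
      exact_mod_cast hn
    have hN1' : (1 : ℚ) ≤ N := by exact_mod_cast hN1
    have : (t.2 : ℚ) ≤ c * N ^ 2 := by
      rw [hv, eval_eq_of_natDegree_two hF]
      have h2 : F.coeff 2 * (n : ℚ) ^ 2 ≤ |F.coeff 2| * N ^ 2 := by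
        refine (le_abs_self _).trans ?_
        rw [abs_mul, abs_pow]
        gcongr
      have h1 : F.coeff 1 * (n : ℚ) ≤ |F.coeff 1| * N ^ 2 := by
        refine (le_abs_self _).trans ?_
        rw [abs_mul]
        gcongr
        nlinarith
      have h0 : F.coeff 0 ≤ |F.coeff 0| * N ^ 2 := by
        refine (le_abs_self _).trans (le_mul_of_one_le_right (abs_nonneg _) ?_)
        nlinarith
      rw [hc]
      linarith
    exact_mod_cast this
  · rw [bound_eq_mul_exp _ hN1]
    refine mul_lt_mul_of_pos_left ((hK₂ (j + 1) (by omega)).trans_le (Real.exp_le_exp.2 ?_)) hN0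
    have hNle : N ≤ ((j + 1) ^ 2) ^ (j + 1) := by
      refine le_trans ?_ (modulus_succ_le hF0 hj)
      refine (Nat.pow_le_pow_iff_left two_ne_zero).1 (le_trans ?_ hge)
      exact Nat.le_mul_of_pos_right _ (by positivity)
    have := log_div_log_log_le (k := j + 1) (by omega) hN hNle
    linarith

/-- The bound is smaller than `N` divided by any power of `log N`. -/
theorem bound_isLittleO {c : ℝ} (hc : 0 < c) (r : ℝ) :
    (fun N : ℕ => bound c N) =o[Filter.atTop] (fun N : ℕ => (N : ℝ) / Real.log (N : ℝ) ^ r) := by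
  have hL : Filter.Tendsto (fun N : ℕ => Real.log (N : ℝ)) Filter.atTop Filter.atTop :=
    Real.tendsto_log_atTop.comp tendsto_natCast_atTop_atTop
  have hLL := Real.tendsto_log_atTop.comp hL
  -- With `y = log log N` the quotient of the two sides is the exponential of this function; `y ^ 2
  -- = o(exp y)` makes the second term dominate.
  have hexp : Filter.Tendsto (fun y : ℝ => r * y - c * (Real.exp y / y)) Filter.atTop
      Filter.atBot := by
    have h1 := (Real.isLittleO_pow_exp_atTop (n := 2)).bound
      (show (0 : ℝ) < c / (|r| + 1) by positivity)
    refine Filter.tendsto_atBot_mono' _ ?_ Filter.tendsto_neg_atTop_atBot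
    filter_upwards [h1, Filter.eventually_gt_atTop 0] with y hy hy0
    rw [Real.norm_eq_abs, Real.norm_eq_abs, Real.abs_exp, abs_of_nonneg (by positivity),
      div_mul_eq_mul_div, le_div_iff₀ (by positivity)] at hy
    have h2 : (|r| + 1) * y ≤ c * (Real.exp y / y) := by
      rw [← mul_div_assoc, le_div_iff₀ hy0]
      linarith
    have h3 : r * y ≤ |r| * y := by gcongr; exact le_abs_self r
    linarith
  rw [Asymptotics.isLittleO_iff_tendsto']
  · have h := Real.tendsto_exp_atBot.comp (hexp.comp hLL)
    refine h.congr' ?_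
    filter_upwards [Filter.eventually_gt_atTop 0, hL.eventually_gt_atTop 0] with N hN hLN
    have hN' : (0 : ℝ) < N := by exact_mod_cast hN
    simp only [Function.comp]
    rw [bound_eq_mul_exp _ hN, Real.exp_log hLN, Real.rpow_def_of_pos hLN, sub_eq_add_neg,
      Real.exp_add]
    field_simp
  · filter_upwards [Filter.eventually_gt_atTop 0, hL.eventually_gt_atTop 0] with N hN hLN h0
    have hN' : (0 : ℝ) < N := by exact_mod_cast hN
    exact absurd h0 (by positivity)

end BSGS
-- The particular series
namespace BSGS

theorem natAbs_pentagonalIndex_le (j : ℕ) : (pentagonalIndex j).natAbs ≤ (j + 1) / 2 := by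
  unfold pentagonalIndex
  split_ifs <;> omega

theorem pentagonal_eq_eval (n : ℤ) :
    (pentagonal n : ℚ) = (Polynomial.C (3 / 2) * Polynomial.X ^ 2 -
      Polynomial.C (1 / 2) * Polynomial.X : Polynomial ℚ).eval (n : ℚ) := by
  have h : (2 * (pentagonal n : ℤ) : ℤ) = n * (3 * n - 1) := two_mul_natCast_pentagonal n
  have h' : (2 * pentagonal n : ℚ) = n * (3 * n - 1) := by exact_mod_cast h
  simp
  linarith

section Terms

variable {R : Type*} [Ring R] (q : R)

theorem termSum_append (l l' : List (ℤˣ × ℕ)) :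
    termSum q (l ++ l') = termSum q l + termSum q l' := by
  simp [termSum]

theorem termSum_seqTerms (e : ℕ → ℕ) (N : ℕ) :
    termSum q (seqTerms e N) = ∑ n ∈ Finset.Icc 1 N, q ^ e n := by
  induction N with
  | zero => simp [seqTerms, termSum]
  | succ N ih =>
    rw [Finset.sum_Icc_succ_top (by omega), ← ih]
    simp [seqTerms, List.range_succ, termSum]

theorem termSum_etaTerms (N : ℕ) :
    termSum q (etaTerms N) = ∑ j ∈ Finset.range N, (-1) ^ (pentagonalIndex j).natAbs *
      q ^ pentagonal (pentagonalIndex j) := by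
  induction N with
  | zero => simp [etaTerms, termSum]
  | succ N ih =>
    rw [Finset.sum_range_succ, ← ih]
    simp [etaTerms, List.range_succ, termSum]

/-- For `N = 0` the list is empty and the constant term `1` is missing. -/
theorem termSum_squareTerms (ε : ℤˣ) {N : ℕ} (hN : 1 ≤ N) :
    termSum q (squareTerms ε N) =
      1 + 2 * ∑ n ∈ Finset.Ico 1 N, ((ε : ℤ) : R) ^ n * q ^ (n ^ 2) := by
  induction N, hN using Nat.le_induction with
  | base => simp [squareTerms, termSum]
  | succ N hN ih =>
    have h : squareTerms ε (N + 1) = squareTerms ε N ++ [(ε ^ N, N ^ 2), (ε ^ N, N ^ 2)] := by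
      simp [squareTerms, List.range_succ, show N ≠ 0 by omega]
    rw [h, termSum_append, ih, Finset.sum_Ico_succ_top hN, mul_add, ← add_assoc]
    simp [termSum, two_mul]

theorem termSum_trigonalTerms (N : ℕ) :
    termSum q (trigonalTerms N) = 2 * ∑ n ∈ Finset.range N, q ^ (n * (n + 1)) := by
  induction N with
  | zero => simp [trigonalTerms, termSum]
  | succ N ih =>
    have h : trigonalTerms (N + 1) =
        trigonalTerms N ++ [(1, N * (N + 1)), (1, N * (N + 1))] := by
      simp [trigonalTerms, List.range_succ]
    rw [h, termSum_append, ih, Finset.sum_range_succ, mul_add (2 : R)]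
    simp [termSum, two_mul (q ^ _)]

end Terms

theorem exists_of_mem_squareTerms {ε : ℤˣ} {N : ℕ} {t : ℤˣ × ℕ} (ht : t ∈ squareTerms ε N) :
    ∃ n : ℤ, n.natAbs ≤ N ∧ (t.2 : ℚ) = (Polynomial.X ^ 2 : Polynomial ℚ).eval (n : ℚ) := by
  simp only [squareTerms, List.mem_flatMap, List.mem_range] at ht
  obtain ⟨n, hn, ht⟩ := ht
  refine ⟨n, by simpa using hn.le, ?_⟩
  split_ifs at ht with h
  · simp_all
  · have : t.2 = n ^ 2 := by
      simp only [List.mem_cons, List.not_mem_nil, or_false, or_self] at ht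
      rw [ht]
    simp [this]

theorem exists_of_mem_trigonalTerms {N : ℕ} {t : ℤˣ × ℕ} (ht : t ∈ trigonalTerms N) :
    ∃ n : ℤ, n.natAbs ≤ N ∧
      (t.2 : ℚ) = (Polynomial.X ^ 2 + Polynomial.X : Polynomial ℚ).eval (n : ℚ) := by
  simp only [trigonalTerms, List.mem_flatMap, List.mem_range] at ht
  obtain ⟨n, hn, ht⟩ := ht
  refine ⟨n, by simpa using hn.le, ?_⟩
  have : t.2 = n * (n + 1) := by
    simp only [List.mem_cons, List.not_mem_nil, or_false, or_self] at ht
    rw [ht]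
  simp [this]
  ring

theorem exists_of_mem_etaTerms {N : ℕ} {t : ℤˣ × ℕ} (ht : t ∈ etaTerms N) :
    ∃ n : ℤ, n.natAbs ≤ N ∧ (t.2 : ℚ) = (Polynomial.C (3 / 2) * Polynomial.X ^ 2 -
      Polynomial.C (1 / 2) * Polynomial.X : Polynomial ℚ).eval (n : ℚ) := by
  simp only [etaTerms, List.mem_map, List.mem_range] at ht
  obtain ⟨j, hj, rfl⟩ := ht
  exact ⟨pentagonalIndex j, by have := natAbs_pentagonalIndex_le j; omega, pentagonal_eq_eval _⟩

end BSGS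

theorem theorem17 :
    -- the bound grows more slowly than `N / log ^ r N`
    (∀ r : ℝ, 0 < r →
      (fun N : ℕ => BSGS.bound (1 / 8) N)
        =o[Filter.atTop] (fun N : ℕ => (N : ℝ) / Real.log (N : ℝ) ^ r)) ∧
    -- general quadratic exponents
    (∀ F : Polynomial ℚ, F.natDegree = 2 →
      (∀ n : ℤ, ∃ z : ℤ, F.eval (n : ℚ) = (z : ℚ)) →
      ∀ e : ℕ → ℕ, (∀ n : ℕ, 1 ≤ n → (e n : ℚ) = F.eval (n : ℚ)) →
      ∀ᶠ N : ℕ in Filter.atTop, ∃ k : ℕ,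
        ((BSGS.bsgs (BSGS.modulus F k) (BSGS.seqTerms e N)).muls : ℝ) < BSGS.bound (1 / 8) N ∧
        ∀ (R : Type u) [Ring R] (q : R),
          (BSGS.bsgs (BSGS.modulus F k) (BSGS.seqTerms e N)).eval q
            = ∑ n ∈ Finset.Icc 1 N, q ^ e n) ∧
    -- the series of `η`
    (∀ᶠ N : ℕ in Filter.atTop, ∃ k : ℕ, ∃ m : ℕ,
        m = BSGS.modulus
          (Polynomial.C (3 / 2) * Polynomial.X ^ 2 - Polynomial.C (1 / 2) * Polynomial.X) k ∧
        ((BSGS.bsgs m (BSGS.etaTerms N)).muls : ℝ) < BSGS.bound (1 / 8) N ∧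
        ∀ (R : Type u) [Ring R] (q : R),
          (BSGS.bsgs m (BSGS.etaTerms N)).eval q
            = ∑ j ∈ Finset.range N, (-1) ^ (BSGS.pentagonalIndex j).natAbs *
                q ^ pentagonal (BSGS.pentagonalIndex j)) ∧
    -- the series of `θ₀`
    (∀ᶠ N : ℕ in Filter.atTop, ∃ k : ℕ, ∃ m : ℕ,
        m = BSGS.modulus (Polynomial.X ^ 2) k ∧
        ((BSGS.bsgs m (BSGS.squareTerms 1 N)).muls : ℝ) < BSGS.bound (1 / 8) N ∧
        ∀ (R : Type u) [Ring R] (q : R),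
          (BSGS.bsgs m (BSGS.squareTerms 1 N)).eval q
            = 1 + 2 * ∑ n ∈ Finset.Ico 1 N, q ^ (n ^ 2)) ∧
    -- the series of `θ₁`
    (∀ᶠ N : ℕ in Filter.atTop, ∃ k : ℕ, ∃ m : ℕ,
        m = BSGS.modulus (Polynomial.X ^ 2) k ∧
        ((BSGS.bsgs m (BSGS.squareTerms (-1) N)).muls : ℝ) < BSGS.bound (1 / 8) N ∧
        ∀ (R : Type u) [Ring R] (q : R),
          (BSGS.bsgs m (BSGS.squareTerms (-1) N)).eval q
            = 1 + 2 * ∑ n ∈ Finset.Ico 1 N, (-1) ^ n * q ^ (n ^ 2)) ∧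
    -- the series of `θ₂`
    (∀ᶠ N : ℕ in Filter.atTop, ∃ k : ℕ, ∃ m : ℕ,
        m = BSGS.modulus (Polynomial.X ^ 2 + Polynomial.X) k ∧
        ((BSGS.bsgs m (BSGS.trigonalTerms N)).muls : ℝ) < BSGS.bound (1 / 8) N ∧
        ∀ (R : Type u) [Ring R] (q : R),
          (BSGS.bsgs m (BSGS.trigonalTerms N)).eval q
            = 2 * ∑ n ∈ Finset.range N, q ^ (n * (n + 1))) := by
  -- All five evaluation claims are instances of `BSGS.eventually_exists_muls_lt`: it remains to
  -- write each exponent as `F(n)` with `|n| ≤ N` and to identify the sum of the terms.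
  refine ⟨fun r _ => BSGS.bound_isLittleO (by norm_num) r, ?_, ?_, ?_, ?_, ?_⟩
  · intro F hF _ e he
    filter_upwards [BSGS.eventually_exists_muls_lt.{u} hF] with N ⟨k, hk⟩
    obtain ⟨h1, h2⟩ := hk (BSGS.seqTerms e N) (by
      intro t ht
      simp only [BSGS.seqTerms, List.mem_map, List.mem_range] at ht
      obtain ⟨i, hi, rfl⟩ := ht
      exact ⟨((i + 1 : ℕ) : ℤ), by rw [Int.natAbs_natCast]; omega, by
        simpa using he (i + 1) (by omega)⟩)
    exact ⟨k, h1, fun R _ q => (h2 R q).trans (BSGS.termSum_seqTerms q e N)⟩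
  · have hF : (Polynomial.C (3 / 2) * Polynomial.X ^ 2 - Polynomial.C (1 / 2) * Polynomial.X :
        Polynomial ℚ).natDegree = 2 := by compute_degree!
    filter_upwards [BSGS.eventually_exists_muls_lt.{u} hF] with N ⟨k, hk⟩
    obtain ⟨h1, h2⟩ := hk (BSGS.etaTerms N) fun t ht => BSGS.exists_of_mem_etaTerms ht
    exact ⟨k, _, rfl, h1, fun R _ q => (h2 R q).trans (BSGS.termSum_etaTerms q N)⟩
  · filter_upwards [BSGS.eventually_exists_muls_lt.{u} (Polynomial.natDegree_X_pow 2),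
      Filter.eventually_ge_atTop 1] with N ⟨k, hk⟩ hN
    obtain ⟨h1, h2⟩ := hk (BSGS.squareTerms 1 N) fun t ht => BSGS.exists_of_mem_squareTerms ht
    exact ⟨k, _, rfl, h1, fun R _ q => by
      simpa using (h2 R q).trans (BSGS.termSum_squareTerms q 1 hN)⟩
  · filter_upwards [BSGS.eventually_exists_muls_lt.{u} (Polynomial.natDegree_X_pow 2),
      Filter.eventually_ge_atTop 1] with N ⟨k, hk⟩ hN
    obtain ⟨h1, h2⟩ := hk (BSGS.squareTerms (-1) N) fun t ht => BSGS.exists_of_mem_squareTerms ht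
    exact ⟨k, _, rfl, h1, fun R _ q => by
      simpa using (h2 R q).trans (BSGS.termSum_squareTerms q (-1) hN)⟩
  · have hF : (Polynomial.X ^ 2 + Polynomial.X : Polynomial ℚ).natDegree = 2 := by
      compute_degree!
    filter_upwards [BSGS.eventually_exists_muls_lt.{u} hF] with N ⟨k, hk⟩
    obtain ⟨h1, h2⟩ := hk (BSGS.trigonalTerms N) fun t ht => BSGS.exists_of_mem_trigonalTerms ht
    exact ⟨k, _, rfl, h1, fun R _ q => (h2 R q).trans (BSGS.termSum_trigonalTerms q N)⟩
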